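/- **Setting.** Let $d\ge 1$, $n\ge 1$, $0\le t<n$, $N=d^n$ and $1\le f\le N$ be integers, and $\mathbb Z_d=\{0,\dots,d-1\}$. For strings $x,y$ of equal length let $\mathrm{pre}(x,y)$ and $\mathrm{suf}(x,y)$ denote the lengths of their longest common prefix and suffix; for $x=x_1\cdots x_n$ put $x'=x_1\cdots x_{n-1}$. *Network.* A $d$-ary inverse Banyan plane has inputs and outputs labelled by $\mathbb Z_d^n$ and $n$ stages of switching elements (SEs), those of each stage labelled by $\mathbb Z_d^{n-1}$. Input $x$ is attached to SE $x'$ of stage $1$, output $y$ to SE $y'$ of stage $n$, and SE $z$ of stage $i\le n-1$ is linked to the SEs of stage $i+1$ whose labels agree with $z$ except possibly in position $i$. Thus there is a unique path (route) from $x$ to $y$; it uses SE $y_1\cdots y_{i-1}x_i\cdots x_{n-1}$ in stage $i$. The network $\log_d(N,0,m)$ consists of $m$ parallel copies (planes) with common inputs and outputs. An $f$-cast request $(a,B)$ consists of an idle input $a$ and a set $B$ of idle outputs, $1\le|B|\le f$. The windows are the $d^{n-t}$ sets of $d^t$ outputs having a common prefix of length $n-t$. The window algorithm with window size $d^t$ routes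 $(a,B)$ by choosing, for every window $W$ that meets $B$, one plane on which all routes from $a$ to $B\cap W$ are set up (the choice is otherwise free). The network is crosstalk-free if no two routes of different requests on the same plane share an SE. It is *crosstalk-free $f$-cast wide-sense nonblocking under the window algorithm* if, in every state reachable from the empty state by routing $f$-cast requests crosstalk-free with this algorithm and releasing requests, every new $f$-cast request can be routed by this algorithm without disturbing existing routes and keeping the network crosstalk-free. *Dual linear program.* Fix an input $a$, a window $W_0$ and a nonempty $B\subseteq W_0$ with $k=|B|\le f$. Let $\mathcal A$ be the set of inputs $u\ne a$, and $i(u)=\mathrm{suf}(u',a')$. Let $B_j$ be the set of outputs $v\notin B$ with $\mathrm{pre}(v',b')=j$ for some $b\in B$. For a window $w\ne W_0$ let $j(w)$ be the $j$ with $w\subseteq B_j$ (the length of the longest common prefix of the prefixes defining $w$ and $W_0$), and for $v\in W_0\setminus B$ let $j(v)$ be the largest $j$ with $v\in B_j$. The dual LP is $$\min\ \sum_{w} d^t\alpha_w+\sum_{u,w}\beta_{u,w}+\sum_{u}\gamma_u+\sum_{v}\delta_v+\sum_u f\epsilon_u$$ with all variables nonnegative, subject to $$\alpha_w+\beta_{u,w}+\epsilon_u\ge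 1\ \text{ if } i(u)+j(w)\ge n-1,\qquad \gamma_u+\delta_v+\epsilon_u\ge 1\ \text{ if } i(u)+j(v)\ge n-1,$$ where $u$ ranges over $\mathcal A$, $w$ over the windows other than $W_0$, $v$ over $W_0\setminus B$, and $\beta_{u,w}$ exists only for pairs with $i(u)+j(w)\ge n-1$. *The family.* For integers $0\le p\le n-t-1$ and $n-t\le q\le n$ let all variables be $0$ except the following, which are $1$: - $\epsilon_u$ if $i(u)\ge n-p$; - if $t\ge\lceil n/2\rceil$: $\beta_{u,w}$ if $p\le j(w)\le n-t-1$ and $n-1-j(w)\le i(u)\le n-p-1$; - if $p+1\le t\le\lceil n/2\rceil-1$: $\beta_{u,w}$ if $p\le j(w)\le t-1$ and $n-1-j(w)\le i(u)\le n-p-1$, and $\alpha_w$ if $t\le j(w)\le n-t-1$; - if $t\le p$: $\alpha_w$ if $p\le j(w)\le n-t-1$; - $\delta_v$ if $v\in\bigcup_{j=q}^{n-1}B_j$; and, if $q>n-t$, $\gamma_u$ if $n-q\le i(u)\le n-p-1$. *The cost.* Put $\mu_{k,q}=\min\{d^t-k,\;k(d^{n-q}-1)\}$ and define $g(k,p,q)$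 as follows. - If $t\ge\lceil n/2\rceil$: $g=f(d^p-1)+(n-t-p)(d^{n-t+1}-d^{n-t})-d^{n-t}+d^p+d^t-k$ for $q=n-t$, and $g=f(d^p-1)+(n-t-p)(d^{n-t+1}-d^{n-t})-d^{n-t}+d^q+\mu_{k,q}$ for $q>n-t$. - If $p+1\le t\le\lceil n/2\rceil-1$: $g=f(d^p-1)+(t-p)(d^{n-t+1}-d^{n-t})+d^{n+p-2t}-k$ for $q=n-t$, and $g=f(d^p-1)+(t-p)(d^{n-t+1}-d^{n-t})+d^{n+p-2t}-d^t+d^q-d^p+\mu_{k,q}$ for $q>n-t$. - If $t\le p$: $g=f(d^p-1)+d^{n-p}-k$ for $q=n-t$, and $g=f(d^p-1)+d^{n-p}-d^t+d^q-d^p+\mu_{k,q}$ for $q>n-t$. **Theorem.** (i) For all $a$, $W_0$, $B$ as above and all $0\le p\le n-t-1$, $n-t\le q\le n$, the above solution is feasible for the dual LP, and its objective value is at most $g(k,p,q)$. More precisely, the objective value equals $g(k,p,q)$ if $q=n-t$, and it equals $g(k,p,q)-\mu_{k,q}+\bigl|\bigcup_{j=q}^{n-1}B_j\bigr|$ if $q>n-t$.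 (ii) Consequently, $\log_d(N,0,m)$ is crosstalk-free $f$-cast wide-sense nonblocking under the window algorithm with window size $d^t$ whenever $$m\ \ge\ 1+\max_{1\le k\le\min(f,d^t)}\ \min_{\substack{0\le p\le n-t-1\\ n-t\le q\le n}} g(k,p,q).$$ -/

import Mathlib

namespace Multilog

/-- `d`-ary strings of length `l`; the symbol in position `s` (counted from `0`) of `x` is `x s`. -/
abbrev Str (d l : ℕ) : Type := Fin l → Fin d

variable {d n l m : ℕ}

/-- The prefix of length `n - r` of a string of length `n`. -/
def dropLast (r : ℕ) (x : Str d n) : Str d (n - r) :=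
  fun s => x ⟨s.1, lt_of_lt_of_le s.2 (Nat.sub_le n r)⟩

/-- Length of the longest common prefix of two strings. -/
def preLen (x y : Str d l) : ℕ :=
  Nat.findGreatest (fun k => ∀ s : Fin l, s.1 < k → x s = y s) l

/-- Length of the longest common suffix of two strings. -/
def sufLen (x y : Str d l) : ℕ :=
  Nat.findGreatest (fun k => ∀ s : Fin l, l ≤ s.1 + k → x s = y s) l

/-! ### The inverse Banyan plane

Inputs and outputs are strings of length `n`.  Each of the `n` stages (counted from `0`)
has one switching element (SE) for each string of length `n - 1`. -/

/-- The SE `z` of stage `i` has a link to the SE `z'` of stage `i + 1`: the two labels agree except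
possibly in position `i`. -/
def Linked (i : ℕ) (z z' : Str d (n - 1)) : Prop :=
  ∀ s : Fin (n - 1), s.1 ≠ i → z' s = z s

/-- `P` (the SE visited in each stage) is a path of the plane from the input `x` to the
output `y`. -/
def IsPath (x y : Str d n) (P : Fin n → Str d (n - 1)) : Prop :=
  (∀ i : Fin n, i.1 = 0 → P i = dropLast 1 x) ∧
  (∀ i : Fin n, i.1 + 1 = n → P i = dropLast 1 y) ∧
  (∀ i j : Fin n, j.1 = i.1 + 1 → Linked i.1 (P i) (P j))

/-- The route from the input `x` to the output `y`: in each stage, the SE through which it goes. -/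
def route (x y : Str d n) (i : Fin n) : Str d (n - 1) :=
  fun s => if s.1 < i.1 then dropLast 1 y s else dropLast 1 x s

/-- The route is the unique path of the plane from `x` to `y`. -/
theorem isPath_iff (x y : Str d n) (P : Fin n → Str d (n - 1)) :
    IsPath x y P ↔ P = route x y := by
  constructor
  · rintro ⟨h0, h1, h2⟩
    have hx : ∀ k : ℕ, ∀ hk : k < n, ∀ s : Fin (n - 1), k ≤ s.1 →
        P ⟨k, hk⟩ s = dropLast 1 x s := by
      intro k
      induction k with
      | zero => intro hk s _; rw [h0 ⟨0, hk⟩ rfl]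
      | succ k ih =>
        intro hk s hs
        rw [h2 ⟨k, by omega⟩ ⟨k + 1, hk⟩ rfl s (by simp; omega)]
        exact ih (by omega) s (by omega)
    have hy : ∀ r k : ℕ, ∀ hk : k + 1 + r = n, ∀ s : Fin (n - 1), s.1 < k →
        P ⟨k, by omega⟩ s = dropLast 1 y s := by
      intro r
      induction r with
      | zero => intro k hk s _; rw [h1 ⟨k, by omega⟩ (by simpa using hk)]
      | succ r ih =>
        intro k hk s hs
        rw [← h2 ⟨k, by omega⟩ ⟨k + 1, by omega⟩ rfl s (by simp; omega)]
        exact ih (k + 1) (by omega) s (by omega)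
    funext i s
    unfold route
    split_ifs with h
    · exact hy (n - 1 - i.1) i.1 (by omega) s h
    · exact hx i.1 i.2 s (by omega)
  · rintro rfl
    refine ⟨?_, ?_, ?_⟩
    · intro i hi
      funext s
      simp [route, hi]
    · intro i hi
      funext s
      have := s.2
      rw [route, if_pos (by omega)]
    · intro i j hij s hs
      simp only [route]
      by_cases h : s.1 < i.1
      · rw [if_pos h, if_pos (by omega)]
      · rw [if_neg h, if_neg (by omega)]

/-- The routes from `a` to `b` and from `u` to `v` in one plane have an SE in common. -/
def ShareSE (a b u v : Str d n) : Prop :=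
  ∃ i : Fin n, route a b i = route u v i

/-! ### Requests, states of the network with `m` planes, the window algorithm -/

/-- A multicast request from the input `source` to the set `dests` of outputs. -/
structure Request (d n : ℕ) where
  source : Str d n
  dests : Finset (Str d n)

/-- A request together with the plane on which each branch is routed (the values of `plane` outside
`dests` carry no meaning).  On each plane the connection occupies the SEs of the routes from
`source` to those destinations that are assigned to that plane. -/
structure Connection (d n m : ℕ) extends Request d n where
  plane : Str d n → Fin m

/-- The windows of size `d ^ t` are indexed by strings of length `n - t`; an output lies in the
window given by its prefix of length `n - t`. -/
abbrev windowOf (t : ℕ) (v : Str d n) : Str d (n - t) := dropLast t v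

/-- The rule of the window algorithm: all the destinations of a request that lie in one window are
routed on one plane. -/
def Connection.FollowsWindowRule (t : ℕ) (c : Connection d n m) : Prop :=
  ∀ v ∈ c.dests, ∀ v' ∈ c.dests, windowOf t v = windowOf t v' → c.plane v = c.plane v'

/-- Routes of two different connections share an SE of some plane. -/
def Connection.Crosstalk (c c' : Connection d n m) : Prop :=
  ∃ b ∈ c.dests, ∃ b' ∈ c'.dests,
    c.plane b = c'.plane b' ∧ ShareSE c.source b c'.source b'

/-- A legal new `f`-cast request in a network carrying the connections `S`: an idle input, and at
least one and at most `f` outputs, all idle. -/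
def Request.IsLegal (f : ℕ) (S : Set (Connection d n m)) (r : Request d n) : Prop :=
  r.dests.Nonempty ∧ r.dests.card ≤ f ∧
    ∀ c ∈ S, c.source ≠ r.source ∧ Disjoint c.dests r.dests

/-- `c` is an admissible way to route a new request under the window algorithm in the
crosstalk-free network carrying the connections `S`. -/
def Connection.Admissible (t : ℕ) (S : Set (Connection d n m)) (c : Connection d n m) : Prop :=
  c.FollowsWindowRule t ∧ ∀ c' ∈ S, ¬ c.Crosstalk c'

/-- States of the network that can occur: start with no connection; repeatedly route a legal
request in any way admissible under the window algorithm, or release a connection. -/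
inductive Reachable (f t : ℕ) : Set (Connection d n m) → Prop
  | empty : Reachable f t ∅
  | connect (S : Set (Connection d n m)) (c : Connection d n m) :
      Reachable f t S → c.toRequest.IsLegal f S → c.Admissible t S → Reachable f t (insert c S)
  | release (S : Set (Connection d n m)) (c : Connection d n m) :
      Reachable f t S → c ∈ S → Reachable f t (S \ {c})

/-- The network of `m` planes is crosstalk-free `f`-cast wide-sense nonblocking under the window
algorithm with window size `d ^ t`. -/
def CrosstalkFreeWSNB (d n m f t : ℕ) : Prop :=
  ∀ S : Set (Connection d n m), Reachable f t S →
    ∀ r : Request d n, r.IsLegal f S →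
      ∃ c : Connection d n m, c.toRequest = r ∧ c.Admissible t S

/-! ### The dual linear program

Throughout, `a` is an input and `B` is a set of outputs contained in the window `w₀`. -/

/-- The index `i(u)`: the length of the longest common suffix of `u` and `a`, last symbols
removed. -/
def idxIn (a u : Str d n) : ℕ := sufLen (dropLast 1 u) (dropLast 1 a)

/-- The set `B_j` of outputs outside `B` whose longest common prefix with some member of `B`, last
symbols removed, has length exactly `j`. -/
def outSet (B : Finset (Str d n)) (j : ℕ) : Finset (Str d n) :=
  Finset.univ.filter fun v => v ∉ B ∧ ∃ b ∈ B, preLen (dropLast 1 v) (dropLast 1 b) = j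

/-- The union of the sets `B_j` over `q ≤ j ≤ n - 1`. -/
def outUnion (B : Finset (Str d n)) (q : ℕ) : Finset (Str d n) :=
  (Finset.Icc q (n - 1)).biUnion (outSet B)

/-- The index `j(v)` of an output `v` outside `B`: the largest `j` with `v ∈ B_j`. -/
def idxOut (B : Finset (Str d n)) (v : Str d n) : ℕ :=
  B.sup fun b => preLen (dropLast 1 v) (dropLast 1 b)

/-- The index `j(w)` of a window `w ≠ w₀`: the length of the longest common prefix of `w` and `w₀`,
which is the `j` for which the window `w` is contained in `B_j`. -/
def idxWin {t : ℕ} (w₀ w : Str d (n - t)) : ℕ := preLen w w₀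

/-- All inputs other than `a`. -/
def otherInputs (a : Str d n) : Finset (Str d n) := Finset.univ.erase a

/-- All windows other than `w₀`. -/
def otherWindows {t : ℕ} (w₀ : Str d (n - t)) : Finset (Str d (n - t)) := Finset.univ.erase w₀

/-- The outputs of the window `w₀` outside `B`. -/
def restOutputs {t : ℕ} (w₀ : Str d (n - t)) (B : Finset (Str d n)) : Finset (Str d n) :=
  Finset.univ.filter fun v => windowOf t v = w₀ ∧ v ∉ B

/-- Values for the dual variables.  Only the values at the indices that occur in `Feasible` and
`objective` matter. -/
structure DualVars (d n t : ℕ) where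
  α : Str d (n - t) → ℝ
  β : Str d n → Str d (n - t) → ℝ
  γ : Str d n → ℝ
  δ : Str d n → ℝ
  ε : Str d n → ℝ

/-- The pairs `(u, w)` for which there is a primal variable `x_{u,w}`. -/
def winPairs {t : ℕ} (a : Str d n) (w₀ : Str d (n - t)) : Finset (Str d n × Str d (n - t)) :=
  (otherInputs a ×ˢ otherWindows w₀).filter fun uw => n - 1 ≤ idxIn a uw.1 + idxWin w₀ uw.2

/-- The pairs `(u, v)` for which there is a primal variable `x_{u,v}`. -/
def outPairs {t : ℕ} (a : Str d n) (w₀ : Str d (n - t)) (B : Finset (Str d n)) :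
    Finset (Str d n × Str d n) :=
  (otherInputs a ×ˢ restOutputs w₀ B).filter fun uv => n - 1 ≤ idxIn a uv.1 + idxOut B uv.2

/-- Feasibility for the dual linear program. -/
structure DualVars.Feasible {t : ℕ} (y : DualVars d n t) (a : Str d n) (w₀ : Str d (n - t))
    (B : Finset (Str d n)) : Prop where
  α_nonneg : ∀ w ∈ otherWindows w₀, 0 ≤ y.α w
  β_nonneg : ∀ uw ∈ winPairs a w₀, 0 ≤ y.β uw.1 uw.2
  γ_nonneg : ∀ u ∈ otherInputs a, 0 ≤ y.γ u
  δ_nonneg : ∀ v ∈ restOutputs w₀ B, 0 ≤ y.δ v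
  ε_nonneg : ∀ u ∈ otherInputs a, 0 ≤ y.ε u
  dc1 : ∀ uw ∈ winPairs a w₀, 1 ≤ y.α uw.2 + y.β uw.1 uw.2 + y.ε uw.1
  dc2 : ∀ uv ∈ outPairs a w₀ B, 1 ≤ y.γ uv.1 + y.δ uv.2 + y.ε uv.1

/-- The objective function of the dual linear program. -/
noncomputable def DualVars.objective {t : ℕ} (y : DualVars d n t) (f : ℕ) (a : Str d n)
    (w₀ : Str d (n - t)) (B : Finset (Str d n)) : ℝ :=
  (∑ w ∈ otherWindows w₀, (d : ℝ) ^ t * y.α w)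
    + (∑ uw ∈ winPairs a w₀, y.β uw.1 uw.2)
    + (∑ u ∈ otherInputs a, y.γ u)
    + (∑ v ∈ restOutputs w₀ B, y.δ v)
    + ∑ u ∈ otherInputs a, (f : ℝ) * y.ε u

/-- The family of dual solutions with parameters `0 ≤ p ≤ n - t - 1` and `n - t ≤ q ≤ n`.
Here `(n + 1) / 2` is `n / 2` rounded up.  The three cases for `α` and `β` are
`⌈n / 2⌉ ≤ t`, `p + 1 ≤ t ≤ ⌈n / 2⌉ - 1`, and `t ≤ p`. -/
noncomputable def family {t : ℕ} (a : Str d n) (w₀ : Str d (n - t)) (B : Finset (Str d n))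
    (p q : ℕ) : DualVars d n t where
  α w :=
    if (n + 1) / 2 ≤ t then 0
    else if p + 1 ≤ t then (if t ≤ idxWin w₀ w ∧ idxWin w₀ w ≤ n - t - 1 then 1 else 0)
    else (if p ≤ idxWin w₀ w ∧ idxWin w₀ w ≤ n - t - 1 then 1 else 0)
  β u w :=
    if (n + 1) / 2 ≤ t then
      (if (p ≤ idxWin w₀ w ∧ idxWin w₀ w ≤ n - t - 1) ∧
          (n - 1 - idxWin w₀ w ≤ idxIn a u ∧ idxIn a u ≤ n - p - 1) then 1 else 0)
    else if p + 1 ≤ t then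
      (if (p ≤ idxWin w₀ w ∧ idxWin w₀ w ≤ t - 1) ∧
          (n - 1 - idxWin w₀ w ≤ idxIn a u ∧ idxIn a u ≤ n - p - 1) then 1 else 0)
    else 0
  γ u :=
    if q = n - t then 0
    else (if n - q ≤ idxIn a u ∧ idxIn a u ≤ n - p - 1 then 1 else 0)
  δ v := if v ∈ outUnion B q then 1 else 0
  ε u := if n - p ≤ idxIn a u then 1 else 0

/-- The minimum that occurs in the cost function. -/
def minTerm (d n t k q : ℕ) : ℤ :=
  min ((d : ℤ) ^ t - k) (k * ((d : ℤ) ^ (n - q) - 1))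

/-- The cost function `g(k, p, q)`, with the same three cases as `family`. -/
def cost (d n t f k p q : ℕ) : ℤ :=
  if (n + 1) / 2 ≤ t then
    if q = n - t then
      f * ((d : ℤ) ^ p - 1) + ((n : ℤ) - t - p) * ((d : ℤ) ^ (n - t + 1) - (d : ℤ) ^ (n - t))
        - (d : ℤ) ^ (n - t) + (d : ℤ) ^ p + (d : ℤ) ^ t - k
    else
      f * ((d : ℤ) ^ p - 1) + ((n : ℤ) - t - p) * ((d : ℤ) ^ (n - t + 1) - (d : ℤ) ^ (n - t))
        - (d : ℤ) ^ (n - t) + (d : ℤ) ^ q + minTerm d n t k q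
  else if p + 1 ≤ t then
    if q = n - t then
      f * ((d : ℤ) ^ p - 1) + ((t : ℤ) - p) * ((d : ℤ) ^ (n - t + 1) - (d : ℤ) ^ (n - t))
        + (d : ℤ) ^ (n + p - 2 * t) - k
    else
      f * ((d : ℤ) ^ p - 1) + ((t : ℤ) - p) * ((d : ℤ) ^ (n - t + 1) - (d : ℤ) ^ (n - t))
        + (d : ℤ) ^ (n + p - 2 * t) - (d : ℤ) ^ t + (d : ℤ) ^ q - (d : ℤ) ^ p
        + minTerm d n t k q
  else
    if q = n - t then
      f * ((d : ℤ) ^ p - 1) + (d : ℤ) ^ (n - p) - k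
    else
      f * ((d : ℤ) ^ p - 1) + (d : ℤ) ^ (n - p) - (d : ℤ) ^ t + (d : ℤ) ^ q - (d : ℤ) ^ p
        + minTerm d n t k q

/-- The range `0 ≤ p ≤ n - t - 1`, `n - t ≤ q ≤ n` of the parameters. -/
def paramRange (n t : ℕ) : Finset (ℕ × ℕ) :=
  Finset.Icc 0 (n - t - 1) ×ˢ Finset.Icc (n - t) n

theorem paramRange_nonempty (n t : ℕ) : (paramRange n t).Nonempty :=
  ⟨(0, n), by simp [paramRange]⟩

/-- The minimum of `g(k, p, q)` over the parameters `p` and `q`. -/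
def minCost (d n t f k : ℕ) : ℤ :=
  (paramRange n t).inf' (paramRange_nonempty n t) fun pq => cost d n t f k pq.1 pq.2

theorem kRange_nonempty (d t f : ℕ) (hd : 1 ≤ d) (hf : 1 ≤ f) :
    (Finset.Icc 1 (min f (d ^ t))).Nonempty :=
  Finset.nonempty_Icc.mpr (le_min hf (Nat.one_le_pow t d hd))

/-- The maximum over `1 ≤ k ≤ min(f, d ^ t)` of the minimum over `p` and `q` of `g(k, p, q)`. -/
def maxMinCost (d n t f : ℕ) (hd : 1 ≤ d) (hf : 1 ≤ f) : ℤ :=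
  (Finset.Icc 1 (min f (d ^ t))).sup' (kRange_nonempty d t f hd hf) (minCost d n t f)

end Multilog

/-! The proof is LP weak duality applied to blocked planes. If the routes from `a` to `b` and from
`u` to `v` meet in some stage, that SE label shows a common prefix of `v'`, `b'` and a complementary
common suffix of `u'`, `a'`; hence i(u) + j(v) ≥ n - 1 (`ShareSE.le_sufLen_add_preLen`).

Fix the part `B` of a request in one window and pick one blocking route for each plane blocked for
`B`. Distinct planes give distinct destinations, at most `f` chosen routes leave one input, and by
the window rule at most one joins a given input to a given window. The chosen routes therefore form
a 0/1 primal solution, and every feasible dual solution bounds their number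
(`DualVars.Feasible.card_le_objective`, `IsValidState.card_blocked_le_objective`).

The explicit family is feasible (`family_feasible`), and its value is found by counting strings with
a prescribed prefix or suffix (`objective_family_le`). The switch between `α` and `β` compares
prices: a window with j(w) = j costs d^t through `α` and d^(j+1) - d^p through `β`, so `β` serves
the levels j < t. With more planes than the min-max cost, each window of a request finds an
unblocked plane. Windows can be treated separately, because branches of the same request may share
SEs. -/

namespace Multilog

variable {d n l t m : ℕ}

/-! ### Prefix and suffix lengths as agreement conditions, and cylinder counts. -/

section Strings

theorem preLen_le (x y : Str d l) : preLen x y ≤ l := Nat.findGreatest_le l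

theorem sufLen_le (x y : Str d l) : sufLen x y ≤ l := Nat.findGreatest_le l

/-- Agreement on the first `k` positions passes to smaller `k`, so the greatest such `k` determines
all of them. The search stops at `l`, whence `hk`. -/
theorem le_preLen_iff {x y : Str d l} {k : ℕ} (hk : k ≤ l) :
    k ≤ preLen x y ↔ ∀ s : Fin l, s.1 < k → x s = y s := by
  constructor
  · intro h s hs
    have := Nat.findGreatest_spec (P := fun k => ∀ s : Fin l, s.1 < k → x s = y s)
      (Nat.zero_le l) (fun s hs => absurd hs (Nat.not_lt_zero _))
    exact this s (lt_of_lt_of_le hs h)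
  · intro h
    exact Nat.le_findGreatest hk h

theorem le_sufLen_iff {x y : Str d l} {k : ℕ} (hk : k ≤ l) :
    k ≤ sufLen x y ↔ ∀ s : Fin l, l ≤ s.1 + k → x s = y s := by
  constructor
  · intro h s hs
    have := Nat.findGreatest_spec (P := fun k => ∀ s : Fin l, l ≤ s.1 + k → x s = y s)
      (Nat.zero_le l) (fun s hs => absurd s.2 (by omega))
    exact this s (hs.trans (by unfold sufLen at h; omega))
  · intro h
    exact Nat.le_findGreatest hk h

/-- The strings that agree with `y` on the coordinates satisfying `p`. -/
theorem card_agree (y : Str d l) (p : Fin l → Prop) [DecidablePred p] :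
    (Finset.univ.filter fun x : Str d l => ∀ s, p s → x s = y s).card
      = d ^ (Finset.univ.filter fun s => ¬ p s).card := by
  have : (Finset.univ.filter fun x : Str d l => ∀ s, p s → x s = y s)
      = Fintype.piFinset fun s => if p s then {y s} else Finset.univ := by
    ext x
    simp only [Finset.mem_filter, Finset.mem_univ, true_and, Fintype.mem_piFinset]
    refine forall_congr' fun s => ?_
    by_cases h : p s <;> simp [h]
  rw [this, Fintype.card_piFinset, ← Finset.prod_const, Finset.prod_filter]
  refine Finset.prod_congr rfl fun s _ => ?_
  by_cases h : p s <;> simp [h]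

theorem card_agree_prefix (y : Str d l) (k : ℕ) :
    (Finset.univ.filter fun x : Str d l => ∀ s : Fin l, s.1 < k → x s = y s).card
      = d ^ (l - k) := by
  rw [card_agree y fun s => s.1 < k]
  congr 1
  have := Finset.card_filter_add_card_filter_not (s := (Finset.univ : Finset (Fin l)))
    (fun s => s.1 < k)
  rw [Fin.card_filter_val_lt, Finset.card_univ, Fintype.card_fin] at this
  omega

theorem windowOf_eq_iff {v v' : Str d n} :
    windowOf t v = windowOf t v' ↔ ∀ s : Fin n, s.1 < n - t → v s = v' s := by
  constructor
  · intro h s hs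
    exact congrFun h ⟨s.1, hs⟩
  · intro h
    funext s
    exact h _ s.2

theorem le_preLen_dropLast_iff {v b : Str d n} {q : ℕ} (hq : q ≤ n - 1) :
    q ≤ preLen (dropLast 1 v) (dropLast 1 b) ↔ ∀ s : Fin n, s.1 < q → v s = b s := by
  rw [le_preLen_iff hq]
  constructor
  · intro h s hs
    exact h ⟨s.1, by omega⟩ hs
  · intro h s hs
    exact h _ hs

theorem le_idxIn_iff {a u : Str d n} {i : ℕ} (hi : i ≤ n - 1) :
    i ≤ idxIn a u ↔ ∀ s : Fin n, n - 1 ≤ s.1 + i ∧ s.1 < n - 1 → u s = a s := by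
  rw [idxIn, le_sufLen_iff hi]
  constructor
  · intro h s hs
    exact h ⟨s.1, hs.2⟩ hs.1
  · intro h s hs
    exact h _ ⟨hs, s.2⟩

theorem card_window (ht : t ≤ n) (w : Str d (n - t)) (b : Str d n) (hb : windowOf t b = w) :
    (Finset.univ.filter fun v : Str d n => windowOf t v = w).card = d ^ t := by
  subst hb
  simp only [windowOf_eq_iff]
  rw [card_agree_prefix, Nat.sub_sub_self ht]

end Strings

/-! ### Counting inputs and windows by their indices; the sums over `α` and `β`. -/

section Counting

theorem idxIn_le (a u : Str d n) : idxIn a u ≤ n - 1 := sufLen_le _ _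

/-- For `i < n` the condition fixes the `i` positions just before the last one, leaving `n - i`
free; the `-1` removes `a`. At `i = n` both sides vanish, a case needed for `p = 0`. -/
theorem card_le_idxIn (hn : 1 ≤ n) (a : Str d n) {i : ℕ} (hi : i ≤ n) :
    ((((otherInputs a).filter fun u => i ≤ idxIn a u).card : ℕ) : ℝ) = (d : ℝ) ^ (n - i) - 1 := by
  rcases hi.eq_or_lt with rfl | hlt
  · rw [Finset.filter_false_of_mem]
    · simp
    · intro u _
      have := idxIn_le a u
      omega
  · have hcount : (Finset.univ.filter fun u : Str d n => i ≤ idxIn a u).card = d ^ (n - i) := by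
      simp only [le_idxIn_iff (show i ≤ n - 1 by omega)]
      rw [card_agree]
      congr 1
      have h := Finset.card_filter_add_card_filter_not (s := (Finset.univ : Finset (Fin n)))
        (fun s => n - 1 ≤ s.1 + i ∧ s.1 < n - 1)
      have h' : (Finset.univ.filter fun s : Fin n => n - 1 ≤ s.1 + i ∧ s.1 < n - 1).card = i := by
        rw [← Finset.card_map Fin.valEmbedding]
        have : (Finset.univ.filter fun s : Fin n => n - 1 ≤ s.1 + i ∧ s.1 < n - 1).map
            Fin.valEmbedding = Finset.Ico (n - 1 - i) (n - 1) := by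
          ext k
          simp only [Finset.mem_map, Finset.mem_filter, Finset.mem_univ, true_and,
            Fin.valEmbedding_apply, Finset.mem_Ico]
          constructor
          · rintro ⟨s, hs, rfl⟩
            omega
          · intro hk
            exact ⟨⟨k, by omega⟩, by simp; omega, rfl⟩
        rw [this, Nat.card_Ico]
        omega
      rw [Finset.card_univ, Fintype.card_fin] at h
      omega
    have ha : a ∈ Finset.univ.filter fun u : Str d n => i ≤ idxIn a u := by
      simp only [Finset.mem_filter, Finset.mem_univ, true_and]
      rw [le_idxIn_iff (by omega)]
      intros; rfl
    rw [otherInputs, Finset.filter_erase, Finset.cast_card_erase_of_mem ha, hcount]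
    push_cast
    rfl

theorem card_idxIn_Icc (hn : 1 ≤ n) (a : Str d n) {i k : ℕ} (hik : i ≤ k + 1) (hk : k + 1 ≤ n) :
    ((((otherInputs a).filter fun u => i ≤ idxIn a u ∧ idxIn a u ≤ k).card : ℕ) : ℝ)
      = (d : ℝ) ^ (n - i) - (d : ℝ) ^ (n - (k + 1)) := by
  have h : (otherInputs a).filter (fun u => i ≤ idxIn a u ∧ idxIn a u ≤ k)
      = (otherInputs a).filter (fun u => i ≤ idxIn a u)
        \ (otherInputs a).filter (fun u => k + 1 ≤ idxIn a u) := by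
    ext u
    simp only [Finset.mem_filter, Finset.mem_sdiff]
    by_cases hu : u ∈ otherInputs a <;> simp [hu]
  rw [h, Finset.cast_card_sdiff, card_le_idxIn hn a (hik.trans hk), card_le_idxIn hn a hk]
  · ring
  · intro u hu
    simp only [Finset.mem_filter] at hu ⊢
    exact ⟨hu.1, by omega⟩

theorem idxWin_lt {w₀ w : Str d (n - t)} (h : w ≠ w₀) : idxWin w₀ w < n - t := by
  by_contra hlt
  refine h (funext fun s => (le_preLen_iff le_rfl).1 (not_lt.1 hlt) s s.2)

theorem card_le_idxWin (w₀ : Str d (n - t)) {j : ℕ} (hj : j ≤ n - t) :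
    ((((otherWindows w₀).filter fun w => j ≤ idxWin w₀ w).card : ℕ) : ℝ)
      = (d : ℝ) ^ (n - t - j) - 1 := by
  have hcount : (Finset.univ.filter fun w : Str d (n - t) => j ≤ idxWin w₀ w).card
      = d ^ (n - t - j) := by
    simp only [idxWin, le_preLen_iff hj]
    exact card_agree_prefix w₀ j
  have hw : w₀ ∈ Finset.univ.filter fun w : Str d (n - t) => j ≤ idxWin w₀ w := by
    refine Finset.mem_filter.2 ⟨Finset.mem_univ _, (le_preLen_iff hj).2 ?_⟩
    intros; rfl
  rw [otherWindows, Finset.filter_erase, Finset.cast_card_erase_of_mem hw, hcount]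
  push_cast
  rfl

theorem card_idxWin_eq (w₀ : Str d (n - t)) {j : ℕ} (hj : j < n - t) :
    ((((otherWindows w₀).filter fun w => idxWin w₀ w = j).card : ℕ) : ℝ)
      = (d : ℝ) ^ (n - t - j) - (d : ℝ) ^ (n - t - (j + 1)) := by
  have h : (otherWindows w₀).filter (fun w => idxWin w₀ w = j)
      = (otherWindows w₀).filter (fun w => j ≤ idxWin w₀ w)
        \ (otherWindows w₀).filter (fun w => j + 1 ≤ idxWin w₀ w) := by
    ext w
    simp only [Finset.mem_filter, Finset.mem_sdiff]
    by_cases hw : w ∈ otherWindows w₀ <;> simp [hw]; omega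
  rw [h, Finset.cast_card_sdiff, card_le_idxWin w₀ hj.le, card_le_idxWin w₀ hj]
  · ring
  · intro w hw
    simp only [Finset.mem_filter] at hw ⊢
    exact ⟨hw.1, by omega⟩

theorem sum_alpha (w₀ : Str d (n - t)) (ht : t < n) {p : ℕ} (hp : p ≤ n - t) :
    ∑ w ∈ otherWindows w₀, (d : ℝ) ^ t *
        (if p ≤ idxWin w₀ w ∧ idxWin w₀ w ≤ n - t - 1 then (1 : ℝ) else 0)
      = (d : ℝ) ^ (n - p) - (d : ℝ) ^ t := by
  have h : ∀ w ∈ otherWindows w₀,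
      (if p ≤ idxWin w₀ w ∧ idxWin w₀ w ≤ n - t - 1 then (1 : ℝ) else 0)
        = if p ≤ idxWin w₀ w then 1 else 0 := by
    intro w hw
    have := idxWin_lt (Finset.ne_of_mem_erase hw)
    congr 1
    simp only [eq_iff_iff, and_iff_left_iff_imp]
    omega
  rw [← Finset.mul_sum, Finset.sum_congr rfl h, Finset.sum_boole, card_le_idxWin w₀ hp, mul_sub,
    ← pow_add, mul_one]
  congr 2
  omega

/-- The summand is the number of `β` variables set to 1 at one window. Level `j` has d^(n-t-j) -
d^(n-t-j-1) windows: the term d^(j+1) contributes the same d^(n-t+1) - d^(n-t) at every level, while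
the term d^p telescopes. -/
theorem sum_idxWin_lt (w₀ : Str d (n - t)) {p c : ℕ} (hpc : p ≤ c) (hc : c ≤ n - t) :
    ∑ w ∈ (otherWindows w₀).filter (fun w => p ≤ idxWin w₀ w ∧ idxWin w₀ w < c),
        ((d : ℝ) ^ (idxWin w₀ w + 1) - (d : ℝ) ^ p)
      = ((c : ℝ) - p) * ((d : ℝ) ^ (n - t + 1) - (d : ℝ) ^ (n - t))
        - (d : ℝ) ^ (n - t) + (d : ℝ) ^ (n - t - c + p) := by
  induction c, hpc using Nat.le_induction with
  | base =>
    rw [Finset.filter_false_of_mem (by intros; omega), Nat.sub_add_cancel hc]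
    simp
  | succ c hpc ih =>
    have h : (otherWindows w₀).filter (fun w => p ≤ idxWin w₀ w ∧ idxWin w₀ w < c + 1)
        = (otherWindows w₀).filter (fun w => p ≤ idxWin w₀ w ∧ idxWin w₀ w < c)
          ∪ (otherWindows w₀).filter (fun w => idxWin w₀ w = c) := by
      ext w
      simp only [Finset.mem_filter, Finset.mem_union]
      by_cases hw : w ∈ otherWindows w₀ <;> simp [hw]; omega
    rw [h, Finset.sum_union, ih (by omega)]
    · have h2 : ∑ w ∈ (otherWindows w₀).filter (fun w => idxWin w₀ w = c),
          ((d : ℝ) ^ (idxWin w₀ w + 1) - (d : ℝ) ^ p)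
          = ∑ w ∈ (otherWindows w₀).filter (fun w => idxWin w₀ w = c),
          ((d : ℝ) ^ (c + 1) - (d : ℝ) ^ p) :=
        Finset.sum_congr rfl fun w hw => by rw [(Finset.mem_filter.1 hw).2]
      rw [h2, Finset.sum_const, nsmul_eq_mul, card_idxWin_eq w₀ hc]
      obtain ⟨r, hr⟩ := Nat.exists_eq_add_of_le hc
      have e1 : n - t - c = r + 1 := by omega
      have e2 : n - t - (c + 1) = r := by omega
      rw [e1, e2, hr]
      push_cast
      ring
    · rw [Finset.disjoint_left]
      intro w hw hw'
      simp only [Finset.mem_filter] at hw hw'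
      omega

/-- The cutoff `c` serves two cases of the family: `c = n - t` for large `t`, `c = t` for
intermediate `t`. -/
theorem sum_beta (a : Str d n) (w₀ : Str d (n - t)) {p c : ℕ} (hpc : p ≤ c) (hc : c ≤ n - t)
    (hpn : p + 1 ≤ n - t) :
    ∑ uw ∈ winPairs a w₀,
        (if (p ≤ idxWin w₀ uw.2 ∧ idxWin w₀ uw.2 < c) ∧
          (n - 1 - idxWin w₀ uw.2 ≤ idxIn a uw.1 ∧ idxIn a uw.1 ≤ n - p - 1) then (1 : ℝ) else 0)
      = ((c : ℝ) - p) * ((d : ℝ) ^ (n - t + 1) - (d : ℝ) ^ (n - t))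
        - (d : ℝ) ^ (n - t) + (d : ℝ) ^ (n - t - c + p) := by
  rw [← sum_idxWin_lt w₀ hpc hc, winPairs, Finset.sum_filter, Finset.sum_product_right,
    Finset.sum_filter]
  refine Finset.sum_congr rfl fun w hw => ?_
  split_ifs with hj
  · have hlt := idxWin_lt (Finset.ne_of_mem_erase hw)
    have h := card_idxIn_Icc (by omega) a (i := n - 1 - idxWin w₀ w) (k := n - p - 1)
      (by omega) (by omega)
    rw [show n - (n - 1 - idxWin w₀ w) = idxWin w₀ w + 1 by omega,
      show n - (n - p - 1 + 1) = p by omega] at h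
    rw [← h, ← Finset.sum_boole]
    refine Finset.sum_congr rfl fun u _ => ?_
    simp only [hj, and_self, true_and]
    -- The lower bound on i(u) already places the pair in `winPairs`, so that filter can be dropped.
    rw [← ite_and]
    congr 1
    simp only [eq_iff_iff, and_iff_right_iff_imp]
    omega
  · refine Finset.sum_eq_zero fun u _ => ?_
    simp only [hj, false_and, if_false, ite_self]

end Counting

/-! ### The sets B_j inside the window of `B`. -/

section Outputs

theorem mem_outUnion {B : Finset (Str d n)} {q : ℕ} {v : Str d n} :
    v ∈ outUnion B q ↔
      v ∉ B ∧ ∃ b ∈ B, q ≤ preLen (dropLast 1 v) (dropLast 1 b) := by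
  simp only [outUnion, outSet, Finset.mem_biUnion, Finset.mem_filter, Finset.mem_univ, true_and,
    Finset.mem_Icc]
  constructor
  · rintro ⟨j, hj, hv, b, hb, rfl⟩
    exact ⟨hv, b, hb, hj.1⟩
  · rintro ⟨hv, b, hb, h⟩
    exact ⟨_, ⟨h, preLen_le _ _⟩, hv, b, hb, rfl⟩

theorem agree_of_le_preLen {v b : Str d n} {q : ℕ}
    (h : q ≤ preLen (dropLast 1 v) (dropLast 1 b)) (s : Fin n) (hs : s.1 < q) : v s = b s :=
  (le_preLen_dropLast_iff (h.trans (preLen_le _ _))).1 h s hs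

theorem outUnion_subset_restOutputs {w₀ : Str d (n - t)} {B : Finset (Str d n)}
    (hw : ∀ b ∈ B, windowOf t b = w₀) {q : ℕ} (hq : n - t ≤ q) :
    outUnion B q ⊆ restOutputs w₀ B := by
  intro v hv
  obtain ⟨hvB, b, hb, h⟩ := mem_outUnion.1 hv
  simp only [restOutputs, Finset.mem_filter, Finset.mem_univ, true_and]
  refine ⟨?_, hvB⟩
  rw [← hw b hb, windowOf_eq_iff]
  exact fun s hs => agree_of_le_preLen h s (hs.trans_le hq)

theorem restOutputs_subset_outUnion {w₀ : Str d (n - t)} {B : Finset (Str d n)}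
    (hB : B.Nonempty) (hw : ∀ b ∈ B, windowOf t b = w₀) :
    restOutputs w₀ B ⊆ outUnion B (n - t) := by
  intro v hv
  simp only [restOutputs, Finset.mem_filter, Finset.mem_univ, true_and] at hv
  obtain ⟨b, hb⟩ := hB
  have hvb := windowOf_eq_iff.1 (hv.1.trans (hw b hb).symm)
  -- For `t = 0` the window is the single output `b`, so nothing remains outside `B`; prefix length
  -- `n - t = n` would exceed the maximum `n - 1`.
  rcases Nat.eq_zero_or_pos t with rfl | hpos
  · refine absurd ?_ hv.2
    rwa [show v = b from funext fun s => hvb s s.2]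
  · exact mem_outUnion.2 ⟨hv.2, b, hb, (le_preLen_dropLast_iff (by omega)).2 hvb⟩

theorem card_restOutputs (ht : t ≤ n) {w₀ : Str d (n - t)} {B : Finset (Str d n)}
    (hB : B.Nonempty) (hw : ∀ b ∈ B, windowOf t b = w₀) :
    (((restOutputs w₀ B).card : ℕ) : ℤ) = (d : ℤ) ^ t - B.card := by
  obtain ⟨b, hb⟩ := hB
  have h : restOutputs w₀ B = (Finset.univ.filter fun v : Str d n => windowOf t v = w₀) \ B := by
    ext v
    simp [restOutputs]
  rw [h, Finset.cast_card_sdiff, card_window ht w₀ b (hw b hb)]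
  · push_cast
    rfl
  · intro v hv
    simp [hw v hv]

/-- Two bounds: the union lies in the window minus `B`, and it is covered by the cylinders of prefix
length `q` around the members `b` of `B`, each with `b` removed. -/
theorem card_outUnion_le (ht : t ≤ n) {w₀ : Str d (n - t)} {B : Finset (Str d n)}
    (hB : B.Nonempty) (hw : ∀ b ∈ B, windowOf t b = w₀) {q : ℕ} (hq : n - t ≤ q) :
    (((outUnion B q).card : ℕ) : ℤ) ≤ minTerm d n t B.card q := by
  refine le_min ?_ ?_
  · rw [← card_restOutputs ht hB hw]
    exact_mod_cast Finset.card_le_card (outUnion_subset_restOutputs hw hq)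
  · have hsub : outUnion B q ⊆ B.biUnion fun b =>
        (Finset.univ.filter fun v : Str d n => ∀ s : Fin n, s.1 < q → v s = b s).erase b := by
      intro v hv
      obtain ⟨hvB, b, hb, h⟩ := mem_outUnion.1 hv
      refine Finset.mem_biUnion.2 ⟨b, hb, Finset.mem_erase.2 ⟨?_, ?_⟩⟩
      · rintro rfl
        exact hvB hb
      · simpa using agree_of_le_preLen h
    have hcard := (Finset.card_le_card hsub).trans
      (Finset.card_biUnion_le_card_mul B _ (d ^ (n - q) - 1) fun b _ => by
        rw [Finset.card_erase_of_mem (by simp), card_agree_prefix])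
    obtain ⟨b, _⟩ := hB
    -- Needed to cast the natural subtraction; the cylinder around `b` is nonempty.
    have hpos : 1 ≤ d ^ (n - q) := by
      rw [← card_agree_prefix b q]
      exact Finset.card_pos.2 ⟨b, by simp⟩
    calc (((outUnion B q).card : ℕ) : ℤ) ≤ ((B.card * (d ^ (n - q) - 1) : ℕ) : ℤ) := by
          exact_mod_cast hcard
      _ = _ := by push_cast [hpos]; rfl

theorem sum_delta {w₀ : Str d (n - t)} {B : Finset (Str d n)}
    (hw : ∀ b ∈ B, windowOf t b = w₀) {q : ℕ} (hq : n - t ≤ q) :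
    ∑ v ∈ restOutputs w₀ B, (if v ∈ outUnion B q then (1 : ℝ) else 0)
      = (outUnion B q).card := by
  rw [Finset.sum_boole, Finset.filter_mem_eq_inter,
    Finset.inter_eq_right.2 (outUnion_subset_restOutputs hw hq)]

theorem card_outUnion_sub (ht : t ≤ n) {w₀ : Str d (n - t)} {B : Finset (Str d n)}
    (hB : B.Nonempty) (hw : ∀ b ∈ B, windowOf t b = w₀) :
    (((outUnion B (n - t)).card : ℕ) : ℝ) = (d : ℝ) ^ t - B.card := by
  rw [(outUnion_subset_restOutputs hw le_rfl).antisymm (restOutputs_subset_outUnion hB hw)]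
  exact_mod_cast card_restOutputs ht hB hw

end Outputs

/-! ### Feasibility and objective value of the dual family. -/

section DualSolution

theorem sum_epsilon (hn : 1 ≤ n) (a : Str d n) (f : ℕ) {p : ℕ} (hp : p ≤ n) :
    ∑ u ∈ otherInputs a, (f : ℝ) * (if n - p ≤ idxIn a u then (1 : ℝ) else 0)
      = f * ((d : ℝ) ^ p - 1) := by
  rw [← Finset.mul_sum, Finset.sum_boole, card_le_idxIn hn a (Nat.sub_le n p),
    Nat.sub_sub_self hp]

theorem sum_gamma (a : Str d n) {p q : ℕ} (hpq : p < q) (hq : q ≤ n) :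
    ∑ u ∈ otherInputs a,
        (if n - q ≤ idxIn a u ∧ idxIn a u ≤ n - p - 1 then (1 : ℝ) else 0)
      = (d : ℝ) ^ q - (d : ℝ) ^ p := by
  rw [Finset.sum_boole, card_idxIn_Icc (by omega) a (by omega) (by omega), Nat.sub_sub_self hq]
  congr 2
  omega

/-- If i(u) ≥ n - p, then `ε` covers the constraint. Otherwise i(u) ≤ n - p - 1 forces j(w) ≥ p,
where `α` or `β` is 1. For outputs, `δ` covers j(v) ≥ q, and j(v) < q forces i(u) ≥ n - q, the range
of `γ`. -/
theorem family_feasible (ht : t < n) (a : Str d n) {w₀ : Str d (n - t)} {B : Finset (Str d n)}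
    (hB : B.Nonempty) (hw : ∀ b ∈ B, windowOf t b = w₀) {p q : ℕ} (hp : p ≤ n - t - 1)
    (hq : n - t ≤ q) : (family a w₀ B p q).Feasible a w₀ B where
  α_nonneg w _ := by simp only [family]; split_ifs <;> norm_num
  β_nonneg uw _ := by simp only [family]; split_ifs <;> norm_num
  γ_nonneg u _ := by simp only [family]; split_ifs <;> norm_num
  δ_nonneg v _ := by simp only [family]; split_ifs <;> norm_num
  ε_nonneg u _ := by simp only [family]; split_ifs <;> norm_num
  dc1 := by
    rintro ⟨u, w⟩ huw
    simp only [winPairs, Finset.mem_filter, Finset.mem_product] at huw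
    obtain ⟨⟨_, hww⟩, hij⟩ := huw
    have hlt := idxWin_lt (Finset.ne_of_mem_erase hww)
    simp only [family]
    split_ifs <;> first | (exfalso; omega) | norm_num
  dc2 := by
    rintro ⟨u, v⟩ huv
    simp only [outPairs, Finset.mem_filter, Finset.mem_product] at huv
    obtain ⟨⟨_, hv⟩, hij⟩ := huv
    by_cases hmem : v ∈ outUnion B q
    · simp only [family, if_pos hmem]
      split_ifs <;> norm_num
    -- For `q = n - t`, `δ` is 1 on all remaining outputs of the window, so here `γ` is in force.
    · have hqn : q ≠ n - t := by
        rintro rfl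
        exact hmem (restOutputs_subset_outUnion hB hw hv)
      have hvB : v ∉ B := (Finset.mem_filter.1 hv).2.2
      have hlt : idxOut B v < q := by
        rw [idxOut, Finset.sup_lt_iff (by simp; omega)]
        intro b hb
        by_contra h
        exact hmem (mem_outUnion.2 ⟨hvB, b, hb, not_lt.1 h⟩)
      simp only [family, if_neg hmem, if_neg hqn]
      split_ifs <;> first | (exfalso; omega) | norm_num

/-- The contribution of the variables `α` and `β` to the objective value of the dual solution. -/
theorem sum_alpha_add_sum_beta (ht : t < n) (a : Str d n) (w₀ : Str d (n - t))
    (B : Finset (Str d n)) {p : ℕ} (q : ℕ) (hp : p ≤ n - t - 1) :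
    (∑ w ∈ otherWindows w₀, (d : ℝ) ^ t * (family a w₀ B p q).α w)
        + ∑ uw ∈ winPairs a w₀, (family a w₀ B p q).β uw.1 uw.2
      = if (n + 1) / 2 ≤ t then
          ((n : ℝ) - t - p) * ((d : ℝ) ^ (n - t + 1) - (d : ℝ) ^ (n - t))
            - (d : ℝ) ^ (n - t) + (d : ℝ) ^ p
        else if p + 1 ≤ t then
          ((t : ℝ) - p) * ((d : ℝ) ^ (n - t + 1) - (d : ℝ) ^ (n - t))
            + (d : ℝ) ^ (n + p - 2 * t) - (d : ℝ) ^ t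
        else (d : ℝ) ^ (n - p) - (d : ℝ) ^ t := by
  simp only [family]
  by_cases h1 : (n + 1) / 2 ≤ t
  · simp only [if_pos h1, mul_zero, Finset.sum_const_zero, zero_add,
      show ∀ j, j ≤ n - t - 1 ↔ j < n - t by omega]
    rw [sum_beta a w₀ (by omega) le_rfl (by omega), Nat.sub_self, zero_add,
      Nat.cast_sub ht.le]
  · by_cases h2 : p + 1 ≤ t
    -- Since `t < ⌈n/2⌉`, the cutoff `t` is at most `n - t`: `β` pays for the levels below it, `α`
    -- for the rest.
    · simp only [if_neg h1, if_pos h2]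
      rw [sum_alpha w₀ ht (by omega)]
      simp only [show ∀ j, j ≤ t - 1 ↔ j < t by omega]
      rw [sum_beta a w₀ (by omega) (by omega) (by omega),
        show n - t - t + p = n + p - 2 * t by omega]
      ring
    · simp only [if_neg h1, if_neg h2, Finset.sum_const_zero, add_zero]
      rw [sum_alpha w₀ ht (by omega)]

theorem objective_family_eq (ht : t < n) (f : ℕ) (a : Str d n) {w₀ : Str d (n - t)}
    {B : Finset (Str d n)} (hB : B.Nonempty) (hw : ∀ b ∈ B, windowOf t b = w₀) {p : ℕ}
    (hp : p ≤ n - t - 1) :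
    (family a w₀ B p (n - t)).objective f a w₀ B = (cost d n t f B.card p (n - t) : ℝ) := by
  rw [DualVars.objective, sum_alpha_add_sum_beta ht a w₀ B _ hp]
  simp only [family, if_true, Finset.sum_const_zero]
  rw [sum_epsilon (by omega) a f (by omega), sum_delta hw le_rfl, card_outUnion_sub ht.le hB hw,
    cost]
  simp only [if_true]
  split_ifs <;> push_cast <;> ring

theorem objective_family_of_lt (ht : t < n) (f : ℕ) (a : Str d n) {w₀ : Str d (n - t)}
    {B : Finset (Str d n)} (hw : ∀ b ∈ B, windowOf t b = w₀) {p q : ℕ}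
    (hp : p ≤ n - t - 1) (hq : n - t < q) (hqn : q ≤ n) :
    (family a w₀ B p q).objective f a w₀ B
      = (cost d n t f B.card p q : ℝ) - (minTerm d n t B.card q : ℝ)
        + ((outUnion B q).card : ℝ) := by
  rw [DualVars.objective, sum_alpha_add_sum_beta ht a w₀ B _ hp]
  simp only [family, if_neg hq.ne']
  rw [sum_epsilon (by omega) a f (by omega), sum_delta hw hq.le,
    sum_gamma a (by omega) hqn, cost]
  simp only [if_neg hq.ne']
  split_ifs <;> push_cast <;> ring

theorem objective_family_le (ht : t < n) (f : ℕ) (a : Str d n) {w₀ : Str d (n - t)}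
    {B : Finset (Str d n)} (hB : B.Nonempty) (hw : ∀ b ∈ B, windowOf t b = w₀) {p q : ℕ}
    (hp : p ≤ n - t - 1) (hq : n - t ≤ q) (hqn : q ≤ n) :
    (family a w₀ B p q).objective f a w₀ B ≤ (cost d n t f B.card p q : ℝ) := by
  rcases hq.eq_or_lt with rfl | hlt
  · exact (objective_family_eq ht f a hB hw hp).le
  · rw [objective_family_of_lt ht f a hw hp hlt hqn]
    have : ((outUnion B q).card : ℝ) ≤ (minTerm d n t B.card q : ℝ) := by
      exact_mod_cast card_outUnion_le ht.le hB hw hq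
    linarith

end DualSolution

/-! ### Shared SEs as index inequalities, and weak duality. -/

section WeakDuality

/-- In stage `i` (from 0) a label takes its first `i` symbols from the destination and its last `n -
1 - i` from the source. -/
theorem ShareSE.le_sufLen_add_preLen {a b u v : Str d n} (h : ShareSE a b u v) :
    n - 1 ≤ idxIn a u + preLen (dropLast 1 v) (dropLast 1 b) := by
  obtain ⟨i, hi⟩ := h
  have hi' := i.2
  have hpre : i.1 ≤ preLen (dropLast 1 v) (dropLast 1 b) := by
    rw [le_preLen_iff (by omega)]
    intro s hs
    have := congrFun hi s
    simpa [route, hs] using this.symm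
  have hsuf : n - 1 - i.1 ≤ idxIn a u := by
    rw [idxIn, le_sufLen_iff (by omega)]
    intro s hs
    have := congrFun hi s
    simpa [route, show ¬ s.1 < i.1 by omega] using this.symm
  omega

/-- Outside `w₀`, a common prefix with a member of `B` ends within the first `n - t` symbols, so it
is visible on the windows. This turns a conflict into membership in `winPairs`. -/
theorem idxOut_le_idxWin {w₀ : Str d (n - t)} {B : Finset (Str d n)}
    (hw : ∀ b ∈ B, windowOf t b = w₀) {v : Str d n} (hv : windowOf t v ≠ w₀) :
    idxOut B v ≤ idxWin w₀ (windowOf t v) := by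
  refine Finset.sup_le fun b hb => ?_
  have hle : preLen (dropLast 1 v) (dropLast 1 b) ≤ n - t := by
    by_contra h
    refine hv ?_
    rw [← hw b hb, windowOf_eq_iff]
    exact fun s hs => agree_of_le_preLen le_rfl s (by omega)
  rw [idxWin, le_preLen_iff hle, ← hw b hb]
  exact fun s hs => agree_of_le_preLen (v := v) (b := b) le_rfl ⟨s.1, by omega⟩ hs

/-- Encodes a primal capacity constraint: `C` is d^t for `α` and `f` for `ε`. The injective version
below serves `β`, `γ` and `δ`. -/
theorem sum_comp_le_sum_mul {ι κ : Type*} [DecidableEq κ] {P : Finset ι} {X : Finset κ}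
    {g : ι → κ} {φ : κ → ℝ} {C : ℝ} (hg : ∀ i ∈ P, g i ∈ X) (hφ : ∀ x ∈ X, 0 ≤ φ x)
    (hC : ∀ x ∈ X, ((P.filter fun i => g i = x).card : ℝ) ≤ C) :
    ∑ i ∈ P, φ (g i) ≤ ∑ x ∈ X, C * φ x := by
  rw [← Finset.sum_fiberwise_of_maps_to hg]
  refine Finset.sum_le_sum fun x hx => ?_
  rw [Finset.sum_congr rfl (fun i hi => by rw [(Finset.mem_filter.1 hi).2] :
    ∀ i ∈ P.filter (fun i => g i = x), φ (g i) = φ x), Finset.sum_const, nsmul_eq_mul]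
  exact mul_le_mul_of_nonneg_right (hC x hx) (hφ x hx)

theorem sum_comp_le_sum {ι κ : Type*} [DecidableEq κ] {P : Finset ι} {X : Finset κ}
    {g : ι → κ} {φ : κ → ℝ} (hg : ∀ i ∈ P, g i ∈ X) (hφ : ∀ x ∈ X, 0 ≤ φ x)
    (hinj : Set.InjOn g P) : ∑ i ∈ P, φ (g i) ≤ ∑ x ∈ X, φ x := by
  rw [← Finset.sum_image hinj]
  exact Finset.sum_le_sum_of_subset_of_nonneg (Finset.image_subset_iff.2 hg)
    fun x hx _ => hφ x hx

/-- Weak duality: a family of routes from `u i` to `v i` that obeys the window algorithm and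
conflicts with the routes from `a` to `B` has at most as many members as the value of a feasible
dual solution. -/
theorem DualVars.Feasible.card_le_objective {ι : Type*} {f : ℕ} (ht : t ≤ n) {a : Str d n}
    {w₀ : Str d (n - t)} {B : Finset (Str d n)} (hw : ∀ b ∈ B, windowOf t b = w₀)
    {y : DualVars d n t} (hy : y.Feasible a w₀ B) (P : Finset ι) (u v : ι → Str d n)
    (hu : ∀ i ∈ P, u i ≠ a) (hv : ∀ i ∈ P, v i ∉ B)
    (hidx : ∀ i ∈ P, n - 1 ≤ idxIn a (u i) + idxOut B (v i))
    (hinj : Set.InjOn v P)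
    (hwin : ∀ i ∈ P, ∀ j ∈ P, u i = u j → windowOf t (v i) = windowOf t (v j) → i = j)
    (hf : ∀ x, (P.filter fun i => u i = x).card ≤ f) :
    (P.card : ℝ) ≤ y.objective f a w₀ B := by
  classical
  -- Routes ending outside `w₀` are charged to `dc1`, those ending inside to `dc2`.
  set P₁ := P.filter fun i => windowOf t (v i) ≠ w₀ with hP₁
  set P₂ := P.filter fun i => ¬ windowOf t (v i) ≠ w₀ with hP₂
  have hu' : ∀ i ∈ P, u i ∈ otherInputs a := fun i hi => by simp [otherInputs, hu i hi]
  have m1 : ∀ i ∈ P₁, (u i, windowOf t (v i)) ∈ winPairs a w₀ := by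
    intro i hi
    obtain ⟨hiP, hiw⟩ := Finset.mem_filter.1 hi
    refine Finset.mem_filter.2 ⟨Finset.mem_product.2 ⟨hu' i hiP, ?_⟩, ?_⟩
    · exact Finset.mem_erase.2 ⟨hiw, Finset.mem_univ _⟩
    · have := hidx i hiP
      have := idxOut_le_idxWin hw hiw
      dsimp only
      omega
  have m1' : ∀ i ∈ P₁, windowOf t (v i) ∈ otherWindows w₀ := fun i hi =>
    (Finset.mem_product.1 (Finset.mem_filter.1 (m1 i hi)).1).2
  have m2' : ∀ i ∈ P₂, v i ∈ restOutputs w₀ B := by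
    intro i hi
    obtain ⟨hiP, hiw⟩ := Finset.mem_filter.1 hi
    exact Finset.mem_filter.2 ⟨Finset.mem_univ _, not_not.1 hiw, hv i hiP⟩
  have m2 : ∀ i ∈ P₂, (u i, v i) ∈ outPairs a w₀ B := fun i hi =>
    Finset.mem_filter.2 ⟨Finset.mem_product.2
      ⟨hu' i (Finset.mem_filter.1 hi).1, m2' i hi⟩, hidx i (Finset.mem_filter.1 hi).1⟩
  have hsplit : (P.card : ℝ) = ∑ i ∈ P₁, (1 : ℝ) + ∑ i ∈ P₂, (1 : ℝ) := by
    rw [Finset.sum_filter_add_sum_filter_not]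
    simp
  have s1 : ∑ i ∈ P₁, (1 : ℝ) ≤ ∑ i ∈ P₁, y.α (windowOf t (v i))
      + ∑ i ∈ P₁, y.β (u i) (windowOf t (v i)) + ∑ i ∈ P₁, y.ε (u i) := by
    rw [← Finset.sum_add_distrib, ← Finset.sum_add_distrib]
    exact Finset.sum_le_sum fun i hi => hy.dc1 _ (m1 i hi)
  have s2 : ∑ i ∈ P₂, (1 : ℝ) ≤ ∑ i ∈ P₂, y.γ (u i)
      + ∑ i ∈ P₂, y.δ (v i) + ∑ i ∈ P₂, y.ε (u i) := by
    rw [← Finset.sum_add_distrib, ← Finset.sum_add_distrib]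
    exact Finset.sum_le_sum fun i hi => hy.dc2 _ (m2 i hi)
  have hα : ∑ i ∈ P₁, y.α (windowOf t (v i)) ≤ ∑ w ∈ otherWindows w₀, (d : ℝ) ^ t * y.α w := by
    refine sum_comp_le_sum_mul m1' hy.α_nonneg fun w _ => ?_
    rcases (P₁.filter fun i => windowOf t (v i) = w).eq_empty_or_nonempty with h | ⟨i, hi⟩
    · rw [h]
      simp
    · rw [Finset.mem_filter] at hi
      rw [← Nat.cast_pow, ← card_window ht w (v i) hi.2]
      refine Nat.cast_le.2 (Finset.card_le_card_of_injOn v ?_ ?_)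
      · intro j hj
        simpa using (Finset.mem_filter.1 hj).2
      · refine hinj.mono fun j hj => ?_
        exact (Finset.mem_filter.1 (Finset.mem_filter.1 hj).1).1
  have hβ : ∑ i ∈ P₁, y.β (u i) (windowOf t (v i)) ≤ ∑ uw ∈ winPairs a w₀, y.β uw.1 uw.2 := by
    refine sum_comp_le_sum (g := fun i => (u i, windowOf t (v i)))
      (φ := fun uw => y.β uw.1 uw.2) m1 hy.β_nonneg fun i hi j hj hij => ?_
    rw [Prod.mk.injEq] at hij
    exact hwin i (Finset.mem_filter.1 hi).1 j (Finset.mem_filter.1 hj).1 hij.1 hij.2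
  -- All these routes end in the one window `w₀`, so `hwin` allows one per input.
  have hγ : ∑ i ∈ P₂, y.γ (u i) ≤ ∑ x ∈ otherInputs a, y.γ x := by
    refine sum_comp_le_sum (fun i hi => hu' i (Finset.mem_filter.1 hi).1) hy.γ_nonneg
      fun i hi j hj hij => ?_
    obtain ⟨hi, hi'⟩ := Finset.mem_filter.1 hi
    obtain ⟨hj, hj'⟩ := Finset.mem_filter.1 hj
    exact hwin i hi j hj hij ((not_not.1 hi').trans (not_not.1 hj').symm)
  have hδ : ∑ i ∈ P₂, y.δ (v i) ≤ ∑ x ∈ restOutputs w₀ B, y.δ x :=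
    sum_comp_le_sum m2' hy.δ_nonneg (hinj.mono fun i hi => (Finset.mem_filter.1 hi).1)
  -- The two sums are merged before counting, since `f` bounds the routes from an input over both
  -- classes together.
  have hε : ∑ i ∈ P₁, y.ε (u i) + ∑ i ∈ P₂, y.ε (u i)
      ≤ ∑ x ∈ otherInputs a, (f : ℝ) * y.ε x := by
    rw [Finset.sum_filter_add_sum_filter_not]
    exact sum_comp_le_sum_mul hu' hy.ε_nonneg fun x _ => Nat.cast_le.2 (hf x)
  rw [DualVars.objective]
  linarith

end WeakDuality

/-! ### From blocked planes to the nonblocking property. -/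

section Nonblocking

/-- The properties of a state that every reachable state has. -/
structure IsValidState (f t : ℕ) (S : Set (Connection d n m)) : Prop where
  card_le : ∀ c ∈ S, c.dests.card ≤ f
  followsWindowRule : ∀ c ∈ S, c.FollowsWindowRule t
  eq_of_source_eq : ∀ c ∈ S, ∀ c' ∈ S, c.source = c'.source → c = c'
  eq_of_mem_dests : ∀ c ∈ S, ∀ c' ∈ S, ∀ v, v ∈ c.dests → v ∈ c'.dests → c = c'

theorem Reachable.isValidState {f t : ℕ} {S : Set (Connection d n m)} (h : Reachable f t S) :
    IsValidState f t S := by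
  induction h with
  | empty => constructor <;> simp
  | connect S c _ hl ha ih =>
    obtain ⟨_, hcard, hdisj⟩ := hl
    refine ⟨?_, ?_, ?_, ?_⟩
    · rintro c' (rfl | hc')
      exacts [hcard, ih.card_le c' hc']
    · rintro c' (rfl | hc')
      exacts [ha.1, ih.followsWindowRule c' hc']
    · rintro c₁ (rfl | h₁) c₂ (rfl | h₂) he
      · rfl
      · exact absurd he.symm (hdisj c₂ h₂).1
      · exact absurd he (hdisj c₁ h₁).1
      · exact ih.eq_of_source_eq c₁ h₁ c₂ h₂ he
    · rintro c₁ (rfl | h₁) c₂ (rfl | h₂) v hv₁ hv₂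
      · rfl
      · exact absurd hv₁ (Finset.disjoint_left.1 (hdisj c₂ h₂).2 hv₂)
      · exact absurd hv₂ (Finset.disjoint_left.1 (hdisj c₁ h₁).2 hv₁)
      · exact ih.eq_of_mem_dests c₁ h₁ c₂ h₂ v hv₁ hv₂
  | release S c _ _ ih =>
    exact ⟨fun c' h => ih.card_le c' h.1, fun c' h => ih.followsWindowRule c' h.1,
      fun c₁ h₁ c₂ h₂ => ih.eq_of_source_eq c₁ h₁.1 c₂ h₂.1,
      fun c₁ h₁ c₂ h₂ => ih.eq_of_mem_dests c₁ h₁.1 c₂ h₂.1⟩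

/-- The plane `e` cannot carry routes from `a` to all members of `B`. -/
def Blocked (S : Set (Connection d n m)) (a : Str d n) (B : Finset (Str d n)) (e : Fin m) : Prop :=
  ∃ c ∈ S, ∃ v ∈ c.dests, c.plane v = e ∧ ∃ b ∈ B, ShareSE a b c.source v

/-- The blocked planes themselves index the chosen routes. Equal sources or a common destination
identify the connection, and then the window rule or the destination identifies the plane. -/
theorem IsValidState.card_blocked_le_objective {f : ℕ} (ht : t ≤ n) {S : Set (Connection d n m)}
    (hS : IsValidState f t S) {a : Str d n} {w₀ : Str d (n - t)} {B : Finset (Str d n)}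
    (hw : ∀ b ∈ B, windowOf t b = w₀) (hidle : ∀ c ∈ S, c.source ≠ a ∧ Disjoint c.dests B)
    {y : DualVars d n t} (hy : y.Feasible a w₀ B) (P : Finset (Fin m))
    (hP : ∀ e ∈ P, Blocked S a B e) : (P.card : ℝ) ≤ y.objective f a w₀ B := by
  classical
  -- `choose!` needs a default connection, which exists only if some plane is blocked.
  rcases P.eq_empty_or_nonempty with rfl | ⟨e₀, he₀⟩
  · exact hy.card_le_objective ht hw ∅ (fun _ => a) (fun _ => a) (by simp) (by simp) (by simp)
      (by simp) (by simp) (by simp)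
  have : Nonempty (Str d n) := ⟨a⟩
  have : Nonempty (Connection d n m) := ⟨(hP e₀ he₀).choose⟩
  choose! c hc v hv hplane b hb hshare using hP
  refine hy.card_le_objective ht hw P (fun e => (c e).source) v
    (fun e he => (hidle _ (hc e he)).1)
    (fun e he => Finset.disjoint_left.1 (hidle _ (hc e he)).2 (hv e he)) ?_ ?_ ?_ ?_
  · intro e he
    refine (hshare e he).le_sufLen_add_preLen.trans (Nat.add_le_add_left ?_ _)
    exact Finset.le_sup (f := fun b => preLen (dropLast 1 (v e)) (dropLast 1 b)) (hb e he)
  · intro e he e' he' hvv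
    have hcc := hS.eq_of_mem_dests _ (hc e he) _ (hc e' he') (v e) (hv e he)
      (hvv ▸ hv e' he')
    rw [← hplane e he, ← hplane e' he', hcc, hvv]
  · intro e he e' he' huu hww
    have hcc := hS.eq_of_source_eq _ (hc e he) _ (hc e' he') huu
    rw [← hplane e he, ← hplane e' he', ← hcc]
    exact hS.followsWindowRule _ (hc e he) _ (hv e he) _ (hcc ▸ hv e' he') hww
  · intro x
    rcases (P.filter fun e => (c e).source = x).eq_empty_or_nonempty with h | ⟨e, he⟩
    · rw [h]
      simp
    · obtain ⟨heP, rfl⟩ := Finset.mem_filter.1 he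
      -- All routes from one source belong to one connection, so `v` embeds these planes into its
      -- destinations.
      refine le_trans (Finset.card_le_card_of_injOn v ?_ ?_) (hS.card_le _ (hc e heP))
      · intro e' he'
        obtain ⟨heP', hs⟩ := Finset.mem_filter.1 he'
        rw [← hS.eq_of_source_eq _ (hc e' heP') _ (hc e heP) hs]
        exact hv e' heP'
      · intro e₁ h₁ e₂ h₂ hvv
        have h₁ := (Finset.mem_filter.1 h₁).1
        have h₂ := (Finset.mem_filter.1 h₂).1
        have hcc := hS.eq_of_mem_dests _ (hc e₁ h₁) _ (hc e₂ h₂) (v e₁) (hv e₁ h₁)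
          (hvv ▸ hv e₂ h₂)
        rw [← hplane e₁ h₁, ← hplane e₂ h₂, hcc, hvv]

theorem exists_not_blocked {f : ℕ} (hd : 1 ≤ d) (ht : t < n) (hf : 1 ≤ f)
    (hm : 1 + maxMinCost d n t f hd hf ≤ (m : ℤ)) {S : Set (Connection d n m)}
    (hS : IsValidState f t S) {a : Str d n} {w₀ : Str d (n - t)} {B : Finset (Str d n)}
    (hB : B.Nonempty) (hBf : B.card ≤ f)
    (hw : ∀ b ∈ B, windowOf t b = w₀) (hidle : ∀ c ∈ S, c.source ≠ a ∧ Disjoint c.dests B) :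
    ∃ e : Fin m, ¬ Blocked S a B e := by
  by_contra! hall
  have hcost : ∀ pq ∈ paramRange n t, (m : ℤ) ≤ cost d n t f B.card pq.1 pq.2 := by
    intro pq hpq
    simp only [paramRange, Finset.mem_product, Finset.mem_Icc] at hpq
    have h := hS.card_blocked_le_objective ht.le hw hidle
      (family_feasible ht a hB hw hpq.1.2 hpq.2.1) Finset.univ fun e _ => hall e
    rw [Finset.card_univ, Fintype.card_fin] at h
    exact_mod_cast h.trans (objective_family_le ht f a hB hw hpq.1.2 hpq.2.1 hpq.2.2)
  have hmin : (m : ℤ) ≤ minCost d n t f B.card := Finset.le_inf' _ _ hcost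
  have hk : B.card ∈ Finset.Icc 1 (min f (d ^ t)) := by
    refine Finset.mem_Icc.2 ⟨hB.card_pos, le_min hBf ?_⟩
    -- A cardinality is nonnegative, whence |B| ≤ d^t.
    have := card_restOutputs ht.le hB hw
    have : ((B.card : ℕ) : ℤ) ≤ ((d ^ t : ℕ) : ℤ) := by push_cast; omega
    exact_mod_cast this
  have hmax : minCost d n t f B.card ≤ maxMinCost d n t f hd hf :=
    Finset.le_sup' (minCost d n t f) hk
  omega

theorem crosstalkFreeWSNB_of_maxMinCost_lt {f : ℕ} (hd : 1 ≤ d) (ht : t < n) (hf : 1 ≤ f)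
    (hm : 1 + maxMinCost d n t f hd hf ≤ (m : ℤ)) : CrosstalkFreeWSNB d n m f t := by
  classical
  intro S hreach r hr
  obtain ⟨hne, hcard, hidle⟩ := hr
  have hS := hreach.isValidState
  have hex : ∀ w : Str d (n - t), (∃ b ∈ r.dests, windowOf t b = w) →
      ∃ e : Fin m, ¬ Blocked S r.source (r.dests.filter fun b => windowOf t b = w) e := by
    rintro w ⟨b, hb, hbw⟩
    refine exists_not_blocked hd ht hf hm hS (w₀ := w) ⟨b, Finset.mem_filter.2 ⟨hb, hbw⟩⟩
      ((Finset.card_le_card (Finset.filter_subset _ _)).trans hcard)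
      (fun b hb => (Finset.mem_filter.1 hb).2)
      fun c hc => ⟨(hidle c hc).1, (hidle c hc).2.mono_right (Finset.filter_subset _ _)⟩
  -- Supplies the default plane for windows that miss the request.
  have : Nonempty (Fin m) := by
    obtain ⟨b, hb⟩ := hne
    exact ⟨(hex _ ⟨b, hb, rfl⟩).choose⟩
  choose! e he using hex
  -- The plane depends only on the window, so the window rule is automatic, and crosstalk in a
  -- window would block its plane.
  refine ⟨{ toRequest := r, plane := fun v => e (windowOf t v) }, rfl, ?_, ?_⟩
  · intro v _ v' _ h
    simp only [h]
  · rintro c' hc' ⟨b, hb, v, hv, hpl, hsh⟩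
    exact he (windowOf t b) ⟨b, hb, rfl⟩
      ⟨c', hc', v, hv, hpl.symm, b, Finset.mem_filter.2 ⟨hb, rfl⟩, hsh⟩

end Nonblocking

end Multilog

theorem mainTheorem5 (d n t f : ℕ) (hd : 1 ≤ d) (ht : t < n) (hf : 1 ≤ f) (hfN : f ≤ d ^ n) :
    (∀ (a : Multilog.Str d n) (w₀ : Multilog.Str d (n - t)) (B : Finset (Multilog.Str d n)),
      B.Nonempty → B.card ≤ f → (∀ b ∈ B, Multilog.windowOf t b = w₀) →
      ∀ p q : ℕ, p ≤ n - t - 1 → n - t ≤ q → q ≤ n →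
        (Multilog.family a w₀ B p q).Feasible a w₀ B ∧
        (Multilog.family a w₀ B p q).objective f a w₀ B
          ≤ (Multilog.cost d n t f B.card p q : ℝ) ∧
        (q = n - t → (Multilog.family a w₀ B p q).objective f a w₀ B
          = (Multilog.cost d n t f B.card p q : ℝ)) ∧
        (n - t < q → (Multilog.family a w₀ B p q).objective f a w₀ B
          = (Multilog.cost d n t f B.card p q : ℝ) - (Multilog.minTerm d n t B.card q : ℝ)
            + ((Multilog.outUnion B q).card : ℝ))) ∧
    (∀ m : ℕ, 1 + Multilog.maxMinCost d n t f hd hf ≤ (m : ℤ) →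
      Multilog.CrosstalkFreeWSNB d n m f t) := by
  refine ⟨fun a w₀ B hB _ hw p q hp hq hqn => ⟨?_, ?_, ?_, ?_⟩, fun m hm => ?_⟩
  · exact Multilog.family_feasible ht a hB hw hp hq
  · exact Multilog.objective_family_le ht f a hB hw hp hq hqn
  · rintro rfl
    exact Multilog.objective_family_eq ht f a hB hw hp
  · exact fun h => Multilog.objective_family_of_lt ht f a hw hp h hqn
  · exact Multilog.crosstalkFreeWSNB_of_maxMinCost_lt hd ht hf hm
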